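/- Let $q$ be a prime, let $\mathcal X_1,\mathcal X_2,\mathcal Y$ be finite sets and let $P_{Y|X_1X_2}$ be a two-user discrete memoryless multiple-access channel. All logarithms are to base 2, $\mathcal U=\{0,\dots,q-1\}$ (identified with $\mathbb F_q$), and $\mathcal W=\{0,\dots,2q-2\}$. A computation code of block length $n$ with message sets $\mathcal M,\mathcal N$ consists of injective codeword assignments $\mathbf t:\mathcal M\to\mathcal U^n$ and $\mathbf v:\mathcal N\to\mathcal U^n$, encoding maps $\mathcal U^n\to\mathcal X_1^n$ and $\mathcal U^n\to\mathcal X_2^n$ from codewords to channel inputs, and a decoder $\mathcal Y^n\to\mathcal W^n$. Its average error probability $P_e^{(n)}$ is the probability, for independent uniformly distributed messages $m,n'$, that the decoder output differs from the entrywise integer sum $\mathbf t(m)+\mathbf v(n')$. A pair $(R_1,R_2)$ is achievable if there are computation codes, one for each block length $n$, with $\lceil 2^{nR_1}\rceil$ and $\lceil 2^{nR_2}\rceil$ messages and $P_e^{(n)}\to0$. Let $P_{X_1|U}$ and $P_{X_2|U}$ be arbitrary conditional distributions from $\mathcal U$ to $\mathcal X_1$ and to $\mathcal X_2$. Let $U_1,U_2$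 be independent and uniform on $\mathcal U$, and let $$P_{U_1U_2Y}(u_1,u_2,y)=\sum_{x_1,x_2}\tfrac1{q^2}P_{X_1|U}(x_1|u_1)P_{X_2|U}(x_2|u_2)P_{Y|X_1X_2}(y|x_1,x_2).$$ Let $D(q)=H(U_1+U_2)-\log q$, where $U_1+U_2$ is the integer sum. If $$\max\{R_1,R_2\}<I(U_1+U_2;Y)-D(q),$$ then $(R_1,R_2)$ is achievable. Moreover, with $k_j=\max\{0,\lfloor nR_j/\log q\rfloor\}$ there are computation codes with message sets $\mathbb F_q^{k_1},\mathbb F_q^{k_2}$ and $P_e^{(n)}\to0$ whose codebooks are nested linear codes with dithers: $\mathbf t(m)=\mathbf G[m;\mathbf 0]\oplus \mathbf d_1$ and $\mathbf v(n')=\mathbf G[n';\mathbf 0]\oplus\mathbf d_2$, with a common generator matrix $\mathbf G\in\mathbb F_q^{n\times\max\{k_1,k_2\}}$ of full column rank and $\mathbf d_1,\mathbf d_2\in\mathbb F_q^n$, the messages being padded with zeros to length $\max\{k_1,k_2\}$. -/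

import Mathlib

open Filter Topology

noncomputable section

namespace SumMAC

/-- Shannon entropy, in bits, of a probability mass function on a finite set. -/
def entropy {α : Type*} [Fintype α] (p : α → ℝ) : ℝ :=
  -∑ a, p a * Real.logb 2 (p a)

/-- Mutual information `I(A;B) = H(A) + H(B) - H(A,B)`, in bits, of a joint probability mass
function on a product of two finite sets. -/
def mutualInfo {α β : Type*} [Fintype α] [Fintype β] (p : α → β → ℝ) : ℝ :=
  entropy (fun a => ∑ b, p a b) + entropy (fun b => ∑ a, p a b)
    - entropy (fun ab : α × β => p ab.1 ab.2)

/-- The uniform distribution on `{0, …, q-1}`. This set is represented by `ZMod q`, an element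
`u` standing for the integer `u.val`. -/
def PU (q : ℕ) (_u : ZMod q) : ℝ := 1 / q

section Channel

variable (q : ℕ) [NeZero q]

/-- The distribution on `{0, …, 2q-2}` of the integer sum `U₁ + U₂` of two independent
variables that are uniform on `{0, …, q-1}`. -/
def PW (w : Fin (2 * q - 1)) : ℝ :=
  ∑ u₁ : ZMod q, ∑ u₂ : ZMod q, if u₁.val + u₂.val = (w : ℕ) then PU q u₁ * PU q u₂ else 0

/-- `D(q) = H(U₁ + U₂) - log q`. -/
def D : ℝ := entropy (PW q) - Real.logb 2 q

variable {X₁ X₂ Y : Type*} [Fintype X₁] [Fintype X₂]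

/-- The joint distribution of `(U₁, U₂, Y)` when `U₁, U₂` are independent and uniform, `X_j` is
generated from `U_j` by `V_j`, and `Y` from `(X₁, X₂)` by the channel `P`. -/
def PUUY (V₁ : ZMod q → PMF X₁) (V₂ : ZMod q → PMF X₂) (P : X₁ → X₂ → PMF Y)
    (u₁ u₂ : ZMod q) (y : Y) : ℝ :=
  ∑ x₁, ∑ x₂, PU q u₁ * PU q u₂ * (V₁ u₁ x₁).toReal * (V₂ u₂ x₂).toReal * (P x₁ x₂ y).toReal

/-- The joint distribution of `(U₁ + U₂, Y)`, with the sum taken in the integers. -/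
def PWY (V₁ : ZMod q → PMF X₁) (V₂ : ZMod q → PMF X₂) (P : X₁ → X₂ → PMF Y)
    (w : Fin (2 * q - 1)) (y : Y) : ℝ :=
  ∑ u₁ : ZMod q, ∑ u₂ : ZMod q,
    if u₁.val + u₂.val = (w : ℕ) then PUUY q V₁ V₂ P u₁ u₂ y else 0

end Channel

/-- A computation code of block length `n` over `{0, …, q-1}`, with message sets `M` and `N`:
each user assigns to every message its own codeword (distinct messages get distinct codewords)
and maps the codeword to a channel input sequence; the decoder maps a channel output sequence
to an estimate of the integer sum of the two codewords. -/
structure ComputationCode (q : ℕ) (X₁ X₂ Y : Type*) (M N : Type*) (n : ℕ) where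
  /-- codewords of user 1 -/
  t : M → Fin n → ZMod q
  /-- codewords of user 2 -/
  v : N → Fin n → ZMod q
  t_injective : Function.Injective t
  v_injective : Function.Injective v
  /-- channel input sequence of user 1 for a given codeword -/
  enc₁ : (Fin n → ZMod q) → Fin n → X₁
  /-- channel input sequence of user 2 for a given codeword -/
  enc₂ : (Fin n → ZMod q) → Fin n → X₂
  /-- estimate of the sum -/
  dec : (Fin n → Y) → Fin n → Fin (2 * q - 1)

namespace ComputationCode

variable {q n : ℕ} {X₁ X₂ Y M N : Type*} [Fintype Y]

/-- The conditional probability, given the messages `a` and `b`, that over `n` uses of the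
memoryless channel `P` the decoder does not output the integer sum of the two codewords. -/
def condError (c : ComputationCode q X₁ X₂ Y M N n) (P : X₁ → X₂ → PMF Y)
    (a : M) (b : N) : ℝ :=
  ∑ y : Fin n → Y,
    if ∀ i, (c.dec y i : ℕ) = (c.t a i).val + (c.v b i).val then 0
    else ∏ i, (P (c.enc₁ (c.t a) i) (c.enc₂ (c.v b) i) (y i)).toReal

/-- The average sum-decoding error probability, for independent uniform messages. -/
def avgError [Fintype M] [Fintype N] (c : ComputationCode q X₁ X₂ Y M N n)
    (P : X₁ → X₂ → PMF Y) : ℝ :=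
  ∑ a : M, ∑ b : N, 1 / (Fintype.card M : ℝ) * (1 / (Fintype.card N : ℝ)) * c.condError P a b

end ComputationCode

/-- The rate pair `(R₁, R₂)` is achievable: there are computation codes with `2 ^ (n R₁)` and
`2 ^ (n R₂)` messages (rounded up to integers) whose average error probability tends to `0`. -/
def IsAchievable (q : ℕ) {X₁ X₂ Y : Type*} [Fintype Y] (P : X₁ → X₂ → PMF Y)
    (R₁ R₂ : ℝ) : Prop :=
  ∃ c : ∀ n : ℕ, ComputationCode q X₁ X₂ Y
      (Fin ⌈(2 : ℝ) ^ (n * R₁)⌉₊) (Fin ⌈(2 : ℝ) ^ (n * R₂)⌉₊) n,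
    Tendsto (fun n => (c n).avgError P) atTop (𝓝 0)

/-- Append zeros to a vector of length `k` (used for `k ≤ l`). -/
def zeroPad {q k : ℕ} (l : ℕ) (m : Fin k → ZMod q) : Fin l → ZMod q :=
  fun i => if h : (i : ℕ) < k then m ⟨i, h⟩ else 0

/-- The codebooks are nested linear codes of dimensions `k₁`, `k₂`, shifted by dithers: there
are a common generator matrix `G` of full column rank and vectors `d₁`, `d₂` such that message
`m` has codeword `G m ⊕ d_j`, the shorter of the two messages being padded with zeros. -/
def ComputationCode.IsNestedLinear {q n k₁ k₂ : ℕ} {X₁ X₂ Y : Type*}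
    (c : ComputationCode q X₁ X₂ Y (Fin k₁ → ZMod q) (Fin k₂ → ZMod q) n) : Prop :=
  ∃ (G : Matrix (Fin n) (Fin (max k₁ k₂)) (ZMod q)) (d₁ d₂ : Fin n → ZMod q),
    Function.Injective G.mulVec ∧
    (∀ m, c.t m = G.mulVec (zeroPad (max k₁ k₂) m) + d₁) ∧
    (∀ m, c.v m = G.mulVec (zeroPad (max k₁ k₂) m) + d₂)

/-- The rate pair `(R₁, R₂)` is achieved by nested linear codes with dithers, of dimensions
`k_j = ⌊n R_j / log q⌋`. -/
def IsAchievableByNestedLinear (q : ℕ) [NeZero q] {X₁ X₂ Y : Type*} [Fintype Y]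
    (P : X₁ → X₂ → PMF Y) (R₁ R₂ : ℝ) : Prop :=
  ∃ c : ∀ n : ℕ, ComputationCode q X₁ X₂ Y
      (Fin ⌊n * R₁ / Real.logb 2 q⌋₊ → ZMod q) (Fin ⌊n * R₂ / Real.logb 2 q⌋₊ → ZMod q) n,
    (∀ n, (c n).IsNestedLinear) ∧ Tendsto (fun n => (c n).avgError P) atTop (𝓝 0)

end SumMAC

end

/-! The encoders need not be entrywise, so the linear code only has to carry `k = ⌈n R / log q⌉`
dithered message symbols, followed by zeros. Each encoder replaces the zeros by `m = n - k` base-`q`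
digits chosen so that a linear checksum modulo `q ^ m` takes a prescribed value. The checksum is
additive over the integers, so the decoder knows the checksum of the integer sum `W` of the two
input sequences, without having seen `W` itself. It searches the at most `2 ^ (n τ)` sequences that
are conditionally typical given the output, where `τ > H(W|Y)`. For a random checksum a wrong
candidate passes with probability at most `2 q / q ^ m`, so the error probability tends to zero when
`R < log q - H(W|Y) = I(W;Y) - D(q)`. Uniform dithers and checksum values make the input sequences
uniform and independent; averaging over them, and over the random maps `V₁` and `V₂`, yields
deterministic codes. -/

namespace SumMAC

open scoped BigOperators

section FiniteProbability

variable {α β γ ι κ : Type*} [Fintype α] [Fintype γ] [Fintype ι] [Fintype κ]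

lemma sum_toReal_pmf (p : PMF α) : ∑ a, (p a).toReal = 1 := by
  rw [← ENNReal.toReal_sum fun a _ => p.apply_ne_top a, ← tsum_fintype (L := .unconditional α),
    p.tsum_coe, ENNReal.toReal_one]

lemma exists_le_sum_mul {w : ι → ℝ} (hw : ∀ i, 0 ≤ w i) (hw1 : ∑ i, w i = 1) (F : ι → ℝ) :
    ∃ i, F i ≤ ∑ j, w j * F j := by
  obtain ⟨i, -, hi⟩ := (concaveOn_id (𝕜 := ℝ) convex_univ).exists_le_of_centerMass
    (t := Finset.univ) (p := F) (fun i _ => hw i) (by simp [hw1]) fun i _ => Set.mem_univ (F i)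
  exact ⟨i, by simpa [Finset.centerMass, hw1] using hi⟩

lemma exists_expect_le_expect_sum_mul {w : κ → ι → ℝ} (hw : ∀ a i, 0 ≤ w a i)
    (hw1 : ∀ a, ∑ i, w a i = 1) (F : κ → ι → ℝ) :
    ∃ x : κ → ι, 𝔼 a, F a (x a) ≤ 𝔼 a, ∑ i, w a i * F a i := by
  choose x hx using fun a => exists_le_sum_mul (hw a) (hw1 a) (F a)
  exact ⟨x, Finset.expect_le_expect fun a _ => hx a⟩

lemma sum_prod_toReal_pmf {n : ℕ} (p : Fin n → PMF α) :
    ∑ x : Fin n → α, ∏ i, (p i (x i)).toReal = 1 := by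
  rw [← Fintype.prod_sum fun i a => (p i a).toReal]
  simp only [sum_toReal_pmf, Finset.prod_const_one]

lemma toReal_bind_apply (p : PMF α) (f : α → PMF β) (b : β) :
    (p.bind f b).toReal = ∑ a, (p a).toReal * (f a b).toReal := by
  rw [PMF.bind_apply, tsum_fintype, ENNReal.toReal_sum fun a _ =>
    ENNReal.mul_ne_top (p.apply_ne_top a) ((f a).apply_ne_top b)]
  simp only [ENNReal.toReal_mul]

lemma prod_toReal_bind_apply {n : ℕ} (p : Fin n → PMF α) (f : Fin n → α → PMF β) (y : Fin n → β) :
    ∏ i, ((p i).bind (f i) (y i)).toReal =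
      ∑ x : Fin n → α, (∏ i, (p i (x i)).toReal) * ∏ i, (f i (x i) (y i)).toReal := by
  simp only [toReal_bind_apply, Fintype.prod_sum, Finset.prod_mul_distrib]

lemma sum_prod_mul_comp [DecidableEq α] {n : ℕ} (g : γ → α) (p : Fin n → γ → ℝ)
    (F : (Fin n → α) → ℝ) :
    ∑ x : Fin n → γ, (∏ i, p i (x i)) * F (fun i => g (x i)) =
      ∑ w : Fin n → α, (∏ i, ∑ c with g c = w i, p i c) * F w := by
  rw [← Finset.sum_fiberwise Finset.univ (fun (x : Fin n → γ) i => g (x i))]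
  refine Finset.sum_congr rfl fun w _ => ?_
  have hfiber : (Finset.univ.filter fun x : Fin n → γ => (fun i => g (x i)) = w) =
      Fintype.piFinset fun i => Finset.univ.filter fun c => g c = w i := by
    ext x
    simp [funext_iff]
  rw [Finset.prod_univ_sum, Finset.sum_mul, ← hfiber]
  refine Finset.sum_congr rfl fun x hx => ?_
  rw [(Finset.mem_filter.mp hx).2]

end FiniteProbability

section Chernoff

variable {ι : Type*} [Fintype ι] {p Z : ι → ℝ}

lemma exists_pos_lt_of_hasDerivAt_neg {f : ℝ → ℝ} {f' x : ℝ} (h : HasDerivAt f f' x)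
    (hf' : f' < 0) : ∃ s, 0 < s ∧ f (x + s) < f x := by
  obtain ⟨z, hz, hxz⟩ :=
    ((h.hasDerivWithinAt.liminf_right_slope_le hf').and_eventually self_mem_nhdsWithin).exists
  have hpos : 0 < z - x := sub_pos.mpr hxz
  refine ⟨z - x, hpos, ?_⟩
  rw [slope_def_field, div_lt_iff₀ hpos, zero_mul] at hz
  simpa using hz

lemma sum_filter_prod_le_pow (hp : ∀ i, 0 ≤ p i) {s : ℝ} (hs : 0 ≤ s) (n : ℕ) :
    ∑ x : Fin n → ι with 0 ≤ ∑ i, Z (x i), ∏ i, p (x i) ≤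
      (∑ i, p i * Real.exp (s * Z i)) ^ n := by
  rw [Fintype.sum_pow]
  refine (Finset.sum_le_sum fun x hx => ?_).trans
    (Finset.sum_le_univ_sum_of_nonneg fun x => Finset.prod_nonneg fun i _ =>
      mul_nonneg (hp _) (Real.exp_nonneg _))
  rw [Finset.prod_mul_distrib, ← Real.exp_sum, ← Finset.mul_sum]
  exact le_mul_of_one_le_right (Finset.prod_nonneg fun i _ => hp _)
    (Real.one_le_exp (mul_nonneg hs (Finset.mem_filter.mp hx).2))

lemma exists_sum_filter_prod_le_pow (hp : ∀ i, 0 ≤ p i) (hp1 : ∑ i, p i = 1)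
    (hZ : ∑ i, p i * Z i < 0) :
    ∃ ρ : ℝ, 0 ≤ ρ ∧ ρ < 1 ∧
      ∀ n, ∑ x : Fin n → ι with 0 ≤ ∑ i, Z (x i), ∏ i, p (x i) ≤ ρ ^ n := by
  have hmgf : HasDerivAt (fun s => ∑ i, p i * Real.exp (s * Z i)) (∑ i, p i * Z i) 0 := by
    refine HasDerivAt.fun_sum fun i _ => ?_
    simpa using ((hasDerivAt_mul_const (Z i)).exp.const_mul (p i) : HasDerivAt _ _ (0 : ℝ))
  obtain ⟨s, hs, hlt⟩ := exists_pos_lt_of_hasDerivAt_neg hmgf hZ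
  exact ⟨∑ i, p i * Real.exp (s * Z i),
    Finset.sum_nonneg fun i _ => mul_nonneg (hp i) (Real.exp_nonneg _),
    by simpa [hp1] using hlt, sum_filter_prod_le_pow hp hs.le⟩

end Chernoff

section Typicality

variable {α β : Type*} [Fintype α] {r : α → β → ℝ}

/-- The conditional probability of `a` given `b` under the joint mass function `r`, with value `0`
when `b` has probability `0`. -/
noncomputable def condProb (r : α → β → ℝ) (a : α) (b : β) : ℝ :=
  r a b / ∑ a', r a' b

/-- The conditional entropy `H(A|B) = H(A,B) - H(B)`, in bits, of a joint probability mass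
function of `(A, B)`. -/
noncomputable def condEntropy [Fintype β] (r : α → β → ℝ) : ℝ :=
  entropy (fun ab : α × β => r ab.1 ab.2) - entropy (fun b => ∑ a, r a b)

open Classical in
/-- The sequences whose conditional probability given `y` is at least `2 ^ (-n τ)`. For
`τ > H(A|B)` they are conditionally typical. -/
noncomputable def typicalSet (r : α → β → ℝ) (τ : ℝ) {n : ℕ} (y : Fin n → β) :
    Finset (Fin n → α) :=
  {w | (2 : ℝ) ^ (-(n * τ)) ≤ ∏ i, condProb r (w i) (y i)}

lemma condProb_nonneg (hr : ∀ a b, 0 ≤ r a b) (a : α) (b : β) : 0 ≤ condProb r a b :=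
  div_nonneg (hr a b) (Finset.sum_nonneg fun a' _ => hr a' b)

lemma condProb_le_one (hr : ∀ a b, 0 ≤ r a b) (a : α) (b : β) : condProb r a b ≤ 1 :=
  div_le_one_of_le₀ (Finset.single_le_sum (fun a' _ => hr a' b) (Finset.mem_univ a))
    (Finset.sum_nonneg fun a' _ => hr a' b)

lemma sum_condProb_le_one (r : α → β → ℝ) (b : β) : ∑ a, condProb r a b ≤ 1 := by
  simp only [condProb, ← Finset.sum_div]
  exact div_self_le_one _

lemma condProb_pos (hr : ∀ a b, 0 ≤ r a b) {a : α} {b : β} (h : r a b ≠ 0) :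
    0 < condProb r a b :=
  have hpos : 0 < r a b := (hr a b).lt_of_ne' h
  div_pos hpos (Finset.sum_pos' (fun a' _ => hr a' b) ⟨a, Finset.mem_univ a, hpos⟩)

lemma card_typicalSet_le (hr : ∀ a b, 0 ≤ r a b) (τ : ℝ) {n : ℕ} (y : Fin n → β) :
    ((typicalSet r τ y).card : ℝ) ≤ 2 ^ (n * τ) := by
  have hprob (w : Fin n → α) : 0 ≤ ∏ i, condProb r (w i) (y i) :=
    Finset.prod_nonneg fun i _ => condProb_nonneg hr _ _
  have hmass : (typicalSet r τ y).card * (2 : ℝ) ^ (-(n * τ)) ≤ 1 :=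
    calc (typicalSet r τ y).card * (2 : ℝ) ^ (-(n * τ))
        = ∑ _w ∈ typicalSet r τ y, (2 : ℝ) ^ (-(n * τ)) := by
          rw [Finset.sum_const, nsmul_eq_mul]
      _ ≤ ∑ w ∈ typicalSet r τ y, ∏ i, condProb r (w i) (y i) :=
          Finset.sum_le_sum fun w hw => (Finset.mem_filter.mp hw).2
      _ ≤ ∑ w : Fin n → α, ∏ i, condProb r (w i) (y i) :=
          Finset.sum_le_univ_sum_of_nonneg hprob
      _ = ∏ i, ∑ a, condProb r a (y i) :=
          (Fintype.prod_sum fun i a => condProb r a (y i)).symm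
      _ ≤ 1 := Finset.prod_le_one
          (fun i _ => Finset.sum_nonneg fun a _ => condProb_nonneg hr a _)
          fun i _ => sum_condProb_le_one r (y i)
  rwa [Real.rpow_neg zero_le_two, ← div_eq_mul_inv, div_le_one (by positivity)] at hmass

lemma nonneg_sum_of_notMem_typicalSet (hr : ∀ a b, 0 ≤ r a b) {τ : ℝ} {n : ℕ} {w : Fin n → α}
    {y : Fin n → β} (hw : w ∉ typicalSet r τ y) (hne : ∏ i, r (w i) (y i) ≠ 0) :
    0 ≤ ∑ i, (-Real.logb 2 (condProb r (w i) (y i)) - τ) := by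
  have hpos (i : Fin n) : 0 < condProb r (w i) (y i) :=
    condProb_pos hr (Finset.prod_ne_zero_iff.mp hne i (Finset.mem_univ i))
  have hlt : ∏ i, condProb r (w i) (y i) < 2 ^ (-(n * τ)) := by simpa [typicalSet] using hw
  rw [← Real.logb_lt_iff_lt_rpow one_lt_two (Finset.prod_pos fun i _ => hpos i),
    Real.logb_prod _ _ fun i _ => (hpos i).ne'] at hlt
  simp only [Finset.sum_sub_distrib, Finset.sum_neg_distrib, Finset.sum_const, Finset.card_univ,
    Fintype.card_fin, nsmul_eq_mul]
  linarith

variable [Fintype β]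

lemma condEntropy_eq_sum (hr : ∀ a b, 0 ≤ r a b) :
    condEntropy r = ∑ a, ∑ b, r a b * -Real.logb 2 (condProb r a b) := by
  have hlog (a : α) (b : β) : r a b * -Real.logb 2 (condProb r a b) =
      r a b * Real.logb 2 (∑ a', r a' b) - r a b * Real.logb 2 (r a b) := by
    rcases eq_or_ne (r a b) 0 with h | h
    · simp [h]
    · have hden := (div_ne_zero_iff.mp (condProb_pos hr h).ne').2
      rw [condProb, Real.logb_div h hden]
      ring
  simp only [hlog, Finset.sum_sub_distrib]
  rw [Finset.sum_comm (f := fun a b => r a b * Real.logb 2 (∑ a', r a' b))]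
  simp only [← Finset.sum_mul, condEntropy, entropy, Fintype.sum_prod_type]
  ring

lemma condEntropy_nonneg (hr : ∀ a b, 0 ≤ r a b) : 0 ≤ condEntropy r := by
  rw [condEntropy_eq_sum hr]
  exact Finset.sum_nonneg fun a _ => Finset.sum_nonneg fun b _ => mul_nonneg (hr a b)
    (neg_nonneg.mpr
      (Real.logb_nonpos one_lt_two (condProb_nonneg hr a b) (condProb_le_one hr a b)))

lemma exists_sum_notMem_typicalSet_le_pow [DecidableEq α] (hr : ∀ a b, 0 ≤ r a b)
    (hr1 : ∑ a, ∑ b, r a b = 1) {τ : ℝ} (hτ : condEntropy r < τ) :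
    ∃ ρ : ℝ, 0 ≤ ρ ∧ ρ < 1 ∧ ∀ n, ∑ w : Fin n → α, ∑ y : Fin n → β,
      (if w ∈ typicalSet r τ y then 0 else ∏ i, r (w i) (y i)) ≤ ρ ^ n := by
  have hmean : ∑ ab : α × β, r ab.1 ab.2 * (-Real.logb 2 (condProb r ab.1 ab.2) - τ) < 0 := by
    simp only [mul_sub, Finset.sum_sub_distrib, ← Finset.sum_mul, Fintype.sum_prod_type, hr1,
      ← condEntropy_eq_sum hr]
    linarith
  obtain ⟨ρ, hρ0, hρ1, hρ⟩ := exists_sum_filter_prod_le_pow (fun ab : α × β => hr ab.1 ab.2)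
    (by rwa [Fintype.sum_prod_type]) hmean
  refine ⟨ρ, hρ0, hρ1, fun n => le_trans ?_ (hρ n)⟩
  rw [Finset.sum_filter, ← (Equiv.arrowProdEquivProdArrow (Fin n) (fun _ => α)
    fun _ => β).symm.sum_comp, Fintype.sum_prod_type]
  refine Finset.sum_le_sum fun w _ => Finset.sum_le_sum fun y _ => ?_
  change _ ≤ if 0 ≤ ∑ i, (-Real.logb 2 (condProb r (w i) (y i)) - τ)
    then ∏ i, r (w i) (y i) else 0
  have hnonneg : 0 ≤ ∏ i, r (w i) (y i) := Finset.prod_nonneg fun i _ => hr _ _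
  split_ifs with hmem hsum hsum
  · exact hnonneg
  · exact le_rfl
  · exact le_rfl
  · by_contra! hpos
    exact hsum (nonneg_sum_of_notMem_typicalSet hr hmem hpos.ne')

end Typicality

section Collision

lemma card_fiber_mul_card_le {G H K : Type*} [AddGroup G] [Fintype G] [AddGroup H] [DecidableEq H]
    [AddGroup K] [Fintype K] (φ : G →+ H) (ψ : K →+ G) (h : H) :
    Finset.card {g | φ g = h} * Fintype.card K ≤
      Finset.card {k | φ (ψ k) = 0} * Fintype.card G := by
  have hfiber : Finset.card {g | φ g = h} ≤ Nat.card φ.ker := by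
    rw [Nat.card_eq_fintype_card, Fintype.card_of_subtype {g | φ g = 0} (by simp)]
    by_cases hmem : h ∈ Set.range φ
    · exact (AddMonoidHom.card_fiber_eq_of_mem_range φ hmem ⟨0, map_zero φ⟩).le
    · rw [Finset.card_eq_zero.mpr (Finset.filter_eq_empty_iff.mpr fun g _ hg => hmem ⟨g, hg⟩)]
      exact Nat.zero_le _
  have hker : Nat.card (φ.comp ψ).ker = Finset.card {k | φ (ψ k) = 0} := by
    rw [Nat.card_eq_fintype_card, Fintype.card_of_subtype {k | φ (ψ k) = 0} (by simp)]
  have hrange : Nat.card (φ.comp ψ).range ≤ Nat.card φ.range :=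
    AddSubgroup.card_le_of_le (by rw [AddMonoidHom.range_comp]; exact AddSubgroup.map_le_range ..)
  rw [← Nat.card_eq_fintype_card, ← Nat.card_eq_fintype_card,
    ← AddSubgroup.card_mul_index (φ.comp ψ).ker, ← AddSubgroup.card_mul_index φ.ker,
    AddSubgroup.index_ker, AddSubgroup.index_ker, hker, mul_left_comm]
  gcongr

lemma card_filter_mul_intCast_eq_zero_le {N : ℕ} [NeZero N] {δ : ℤ} (hδ : δ ≠ 0) :
    Finset.card {b : ZMod N | b * δ = 0} ≤ δ.natAbs := by
  refine le_trans (le_of_eq ?_)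
    (IsAddCyclic.card_nsmul_eq_zero_le (α := ZMod N) (Int.natAbs_pos.mpr hδ))
  congr 2 with b
  rw [natAbs_nsmul_eq_zero, zsmul_eq_mul, mul_comm]

lemma expect_sum_mul_intCast_eq_le {ι : Type*} [Fintype ι] [DecidableEq ι] {N : ℕ} [NeZero N]
    {δ : ι → ℤ} {i₀ : ι} (hδ : δ i₀ ≠ 0) (g : ZMod N) :
    (𝔼 A : ι → ZMod N, if g = ∑ i, A i * (δ i : ZMod N) then (1 : ℝ) else 0) ≤
      (δ i₀).natAbs / N := by
  have hcard := card_fiber_mul_card_le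
    (Fintype.linearCombination (ZMod N) fun i => (δ i : ZMod N)).toAddMonoidHom
    (AddMonoidHom.single (fun _ : ι => ZMod N) i₀) g
  simp only [LinearMap.toAddMonoidHom_coe, AddMonoidHom.single_apply,
    Fintype.linearCombination_apply, smul_eq_mul, Pi.single_apply, ite_mul, zero_mul,
    Finset.sum_ite_eq', Finset.mem_univ, if_true, ZMod.card] at hcard
  have hN : (0 : ℝ) < N := Nat.cast_pos.mpr (NeZero.pos N)
  simp only [eq_comm (a := g)]
  rw [Fintype.expect_eq_sum_div_card, Finset.sum_boole,
    div_le_div_iff₀ (Nat.cast_pos.mpr Fintype.card_pos) hN]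
  exact_mod_cast hcard.trans (Nat.mul_le_mul_right _ (card_filter_mul_intCast_eq_zero_le hδ))

end Collision

section Syndrome

variable {q k m : ℕ}

/-- A linear checksum modulo `q ^ m` of an integer sequence: the residue by which its last `m`
entries, read as (not necessarily reduced) base-`q` digits, exceed the linear form `A` in its first
`k` entries. -/
def syndrome (A : Fin k → ZMod (q ^ m)) : (Fin (k + m) → ℤ) →ₗ[ℤ] ZMod (q ^ m) :=
  Fintype.linearCombination ℤ (Fin.append (-A) fun i => (q : ZMod (q ^ m)) ^ (i : ℕ))

lemma syndrome_apply (A : Fin k → ZMod (q ^ m)) (s : Fin (k + m) → ℤ) :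
    syndrome A s = ∑ i : Fin m, (s (Fin.natAdd k i) : ZMod (q ^ m)) * (q : ZMod (q ^ m)) ^ (i : ℕ) -
      ∑ i, A i * (s (Fin.castAdd m i) : ZMod (q ^ m)) := by
  simp only [syndrome, Fintype.linearCombination_apply, Fin.sum_univ_add, Fin.append_left,
    Fin.append_right, Pi.neg_apply, zsmul_eq_mul, mul_neg, Finset.sum_neg_distrib, mul_comm (A _)]
  ring

variable [NeZero q]

variable (q m) in
lemma digitSum_bijective :
    Function.Bijective fun c : Fin m → ZMod q =>
      ∑ i, (((c i).val : ℤ) : ZMod (q ^ m)) * (q : ZMod (q ^ m)) ^ (i : ℕ) := by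
  have hdigits (c : Fin m → ZMod q) :
      ∑ i, (((c i).val : ℤ) : ZMod (q ^ m)) * (q : ZMod (q ^ m)) ^ (i : ℕ) =
        ((finFunctionFinEquiv fun i => (⟨(c i).val, ZMod.val_lt (c i)⟩ : Fin q) : ℕ) :
          ZMod (q ^ m)) := by
    simp
  rw [Fintype.bijective_iff_injective_and_card]
  refine ⟨fun c c' h => funext fun i => ZMod.val_injective q ?_, by simp [ZMod.card]⟩
  simp only [hdigits] at h
  have hval := ((ZMod.natCast_eq_natCast_iff _ _ _).mp h).eq_of_lt_of_lt (Fin.is_lt _) (Fin.is_lt _)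
  exact Fin.val_congr (congrFun (finFunctionFinEquiv.injective (Fin.ext hval)) i)

/-- A sequence over `{0, …, q-1}` is determined by its first `k` symbols and its syndrome, both of
which can be prescribed freely. -/
noncomputable def splitEquiv (A : Fin k → ZMod (q ^ m)) :
    (Fin (k + m) → ZMod q) ≃ (Fin k → ZMod q) × ZMod (q ^ m) :=
  (Fin.appendEquiv k m).symm.trans <| Equiv.prodCongrRight fun u =>
    (Equiv.ofBijective _ (digitSum_bijective q m)).trans
      (Equiv.subRight (∑ i, A i * (((u i).val : ℤ) : ZMod (q ^ m))))

lemma splitEquiv_apply (A : Fin k → ZMod (q ^ m)) (U : Fin (k + m) → ZMod q) :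
    splitEquiv A U = (fun i => U (Fin.castAdd m i), syndrome A fun i => ((U i).val : ℤ)) := by
  rw [syndrome_apply]
  rfl

lemma splitEquiv_symm_castAdd (A : Fin k → ZMod (q ^ m)) (x : (Fin k → ZMod q) × ZMod (q ^ m))
    (i : Fin k) : (splitEquiv A).symm x (Fin.castAdd m i) = x.1 i := by
  obtain ⟨U, rfl⟩ := (splitEquiv A).surjective x
  rw [Equiv.symm_apply_apply, splitEquiv_apply]

lemma expect_syndrome_eq_zero_le {δ : Fin (k + m) → ℤ} {i₀ : Fin k}
    (hδ : δ (Fin.castAdd m i₀) ≠ 0) :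
    (𝔼 A : Fin k → ZMod (q ^ m), if syndrome A δ = 0 then (1 : ℝ) else 0) ≤
      (δ (Fin.castAdd m i₀)).natAbs / (q : ℝ) ^ m := by
  simpa only [syndrome_apply, sub_eq_zero, Nat.cast_pow] using
    expect_sum_mul_intCast_eq_le (N := q ^ m) (δ := fun i => δ (Fin.castAdd m i)) hδ
      (∑ i : Fin m, (δ (Fin.natAdd k i) : ZMod (q ^ m)) * (q : ZMod (q ^ m)) ^ (i : ℕ))

end Syndrome

section Decoder

variable {q k m : ℕ} [NeZero q]

/-- The integer sum of two elements of `{0, …, q-1}`. -/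
def intSum (u₁ u₂ : ZMod q) : Fin (2 * q - 1) :=
  ⟨u₁.val + u₂.val, by have := ZMod.val_lt u₁; have := ZMod.val_lt u₂; omega⟩

instance : Nonempty (Fin (2 * q - 1)) :=
  ⟨intSum 0 0⟩

/-- The syndrome of a sequence over `{0, …, 2q-2}`. -/
def sumSyndrome (A : Fin k → ZMod (q ^ m)) (w : Fin (k + m) → Fin (2 * q - 1)) : ZMod (q ^ m) :=
  syndrome A fun i => ((w i : ℕ) : ℤ)

/-- The decoder that picks from the list `S` a sequence with syndrome `d` and outputs its first `k`
symbols. -/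
noncomputable def syndromeDecoder (S : Finset (Fin (k + m) → Fin (2 * q - 1)))
    (A : Fin k → ZMod (q ^ m)) (d : ZMod (q ^ m)) : Fin k → Fin (2 * q - 1) :=
  fun i => Function.invFunOn (sumSyndrome A) S d (Fin.castAdd m i)

lemma sumSyndrome_intSum (A : Fin k → ZMod (q ^ m)) (U₁ U₂ : Fin (k + m) → ZMod q) :
    sumSyndrome A (fun i => intSum (U₁ i) (U₂ i)) =
      (splitEquiv A U₁).2 + (splitEquiv A U₂).2 := by
  simp only [splitEquiv_apply, ← map_add]
  rfl

lemma exists_of_syndromeDecoder_ne {S : Finset (Fin (k + m) → Fin (2 * q - 1))}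
    {A : Fin k → ZMod (q ^ m)} {w : Fin (k + m) → Fin (2 * q - 1)} (hw : w ∈ S)
    (hne : syndromeDecoder S A (sumSyndrome A w) ≠ fun i => w (Fin.castAdd m i)) :
    ∃ w' ∈ S, (∃ i, w' (Fin.castAdd m i) ≠ w (Fin.castAdd m i)) ∧
      sumSyndrome A w' = sumSyndrome A w :=
  have h := Function.invFunOn_pos (f := sumSyndrome A) (s := S) ⟨w, hw, rfl⟩
  ⟨_, h.1, Function.ne_iff.mp hne, h.2⟩

lemma expect_sumSyndrome_eq_le {w w' : Fin (k + m) → Fin (2 * q - 1)}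
    (hne : ∃ i, w' (Fin.castAdd m i) ≠ w (Fin.castAdd m i)) :
    (𝔼 A : Fin k → ZMod (q ^ m), if sumSyndrome A w' = sumSyndrome A w then (1 : ℝ) else 0) ≤
      2 * q / (q : ℝ) ^ m := by
  obtain ⟨i₀, hi₀⟩ := hne
  set δ : Fin (k + m) → ℤ := (fun i => ((w' i : ℕ) : ℤ)) - fun i => ((w i : ℕ) : ℤ)
  have hδ : δ (Fin.castAdd m i₀) ≠ 0 :=
    sub_ne_zero.mpr fun h => hi₀ (Fin.ext (Nat.cast_injective h))
  have hδ_le : (δ (Fin.castAdd m i₀)).natAbs ≤ 2 * q := by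
    have : δ (Fin.castAdd m i₀) = (w' (Fin.castAdd m i₀) : ℕ) - (w (Fin.castAdd m i₀) : ℕ) := rfl
    omega
  calc
    _ = 𝔼 A : Fin k → ZMod (q ^ m), if syndrome A δ = 0 then (1 : ℝ) else 0 := by
      refine Finset.expect_congr rfl fun A _ => if_congr ?_ rfl rfl
      rw [map_sub, sub_eq_zero]
      rfl
    _ ≤ (δ (Fin.castAdd m i₀)).natAbs / (q : ℝ) ^ m := expect_syndrome_eq_zero_le hδ
    _ ≤ 2 * q / (q : ℝ) ^ m := by gcongr; exact_mod_cast hδ_le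

lemma expect_syndromeDecoder_ne_le (S : Finset (Fin (k + m) → Fin (2 * q - 1)))
    (w : Fin (k + m) → Fin (2 * q - 1)) :
    (𝔼 A : Fin k → ZMod (q ^ m),
      if syndromeDecoder S A (sumSyndrome A w) = fun i => w (Fin.castAdd m i) then (0 : ℝ) else 1) ≤
      (if w ∈ S then 0 else 1) + S.card * (2 * q / (q : ℝ) ^ m) := by
  by_cases hw : w ∈ S
  · set C := S.filter fun w' => ∃ i, w' (Fin.castAdd m i) ≠ w (Fin.castAdd m i)
    have hunion (A : Fin k → ZMod (q ^ m)) :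
        (if syndromeDecoder S A (sumSyndrome A w) = fun i => w (Fin.castAdd m i)
          then (0 : ℝ) else 1) ≤ ∑ w' ∈ C, if sumSyndrome A w' = sumSyndrome A w then 1 else 0 := by
      have hnonneg (w' : Fin (k + m) → Fin (2 * q - 1)) :
          (0 : ℝ) ≤ if sumSyndrome A w' = sumSyndrome A w then 1 else 0 := by positivity
      split_ifs with h
      · exact Finset.sum_nonneg fun w' _ => hnonneg w'
      · obtain ⟨w', hw', hne, heq⟩ := exists_of_syndromeDecoder_ne hw h
        exact (if_pos heq).ge.trans (Finset.single_le_sum (fun w' _ => hnonneg w')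
          (Finset.mem_filter.mpr ⟨hw', hne⟩))
    calc
      _ ≤ 𝔼 A : Fin k → ZMod (q ^ m), ∑ w' ∈ C,
            if sumSyndrome A w' = sumSyndrome A w then (1 : ℝ) else 0 :=
        Finset.expect_le_expect fun A _ => hunion A
      _ = ∑ w' ∈ C, 𝔼 A : Fin k → ZMod (q ^ m),
            if sumSyndrome A w' = sumSyndrome A w then (1 : ℝ) else 0 :=
        Finset.expect_sum_comm _ _ _
      _ ≤ ∑ w' ∈ C, 2 * q / (q : ℝ) ^ m :=
        Finset.sum_le_sum fun w' hw' => expect_sumSyndrome_eq_le (Finset.mem_filter.mp hw').2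
      _ ≤ (if w ∈ S then 0 else 1) + S.card * (2 * q / (q : ℝ) ^ m) := by
        rw [Finset.sum_const, nsmul_eq_mul, if_pos hw, zero_add]
        gcongr
        exact Finset.filter_subset _ _
  · rw [if_neg hw]
    refine (Finset.expect_le Finset.univ_nonempty (a := 1) fun A _ => by
      split_ifs <;> simp).trans ?_
    exact le_add_of_nonneg_right (by positivity)

end Decoder

section SumLaw

variable {q : ℕ} [NeZero q] {Y : Type*} (Q : ZMod q → ZMod q → PMF Y)

/-- The joint distribution of the integer sum of two independent uniform inputs of the channel `Q`
and the output of `Q`. -/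
noncomputable def sumLaw (w : Fin (2 * q - 1)) (y : Y) : ℝ :=
  ∑ u : ZMod q × ZMod q with intSum u.1 u.2 = w, PU q u.1 * PU q u.2 * (Q u.1 u.2 y).toReal

lemma sumLaw_nonneg (w : Fin (2 * q - 1)) (y : Y) : 0 ≤ sumLaw Q w y :=
  Finset.sum_nonneg fun u _ => by unfold PU; positivity

variable [Fintype Y]

lemma sum_sumLaw_output (w : Fin (2 * q - 1)) : ∑ y, sumLaw Q w y = PW q w := by
  simp only [sumLaw, PW]
  rw [Finset.sum_comm]
  simp only [← Finset.mul_sum, sum_toReal_pmf, mul_one, Finset.sum_filter, Fintype.sum_prod_type,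
    intSum, Fin.ext_iff]

lemma sum_PW : ∑ w, PW q w = 1 := by
  have h (u₁ u₂ : ZMod q) (w : Fin (2 * q - 1)) :
      u₁.val + u₂.val = (w : ℕ) ↔ intSum u₁ u₂ = w := by
    simp [intSum, Fin.ext_iff]
  have hq : (q : ℝ) ≠ 0 := NeZero.ne _
  simp only [PW, h]
  rw [Finset.sum_comm]
  simp_rw [Finset.sum_comm (s := Finset.univ (α := Fin (2 * q - 1)))]
  simp [PU, ZMod.card, hq]

lemma sum_sum_sumLaw : ∑ w, ∑ y, sumLaw Q w y = 1 := by
  simp only [sum_sumLaw_output, sum_PW]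

lemma sum_sum_prod_sumLaw (n : ℕ) :
    ∑ w : Fin n → Fin (2 * q - 1), ∑ y : Fin n → Y, ∏ i, sumLaw Q (w i) (y i) = 1 := by
  have houtput (w : Fin n → Fin (2 * q - 1)) := Fintype.prod_sum fun i y => sumLaw Q (w i) y
  simp only [← houtput]
  rw [← Fintype.sum_pow fun w => ∑ y, sumLaw Q w y, sum_sum_sumLaw, one_pow]

lemma expect_expect_sum_prod_mul {n : ℕ} (F : (Fin n → Fin (2 * q - 1)) → (Fin n → Y) → ℝ) :
    (𝔼 U₁ : Fin n → ZMod q, 𝔼 U₂ : Fin n → ZMod q, ∑ y : Fin n → Y,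
      (∏ i, (Q (U₁ i) (U₂ i) (y i)).toReal) * F (fun i => intSum (U₁ i) (U₂ i)) y) =
      ∑ w, ∑ y, (∏ i, sumLaw Q (w i) (y i)) * F w y := by
  have hq : (q : ℝ) ≠ 0 := NeZero.ne _
  rw [Finset.sum_comm (s := Finset.univ (α := Fin n → Fin (2 * q - 1)))]
  simp only [sumLaw, ← sum_prod_mul_comp]
  rw [Finset.sum_comm, ← (Equiv.arrowProdEquivProdArrow (Fin n) (fun _ => ZMod q)
    fun _ => ZMod q).symm.sum_comp, Fintype.sum_prod_type]
  simp only [Fintype.expect_eq_sum_div_card, Finset.sum_div]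
  refine Finset.sum_congr rfl fun U₁ _ => Finset.sum_congr rfl fun U₂ _ =>
    Finset.sum_congr rfl fun y _ => ?_
  simp only [Equiv.arrowProdEquivProdArrow, Equiv.coe_fn_symm_mk, PU, one_div, inv_pow,
    Finset.prod_mul_distrib, Finset.prod_const, Finset.card_univ, Fintype.card_fin,
    Fintype.card_fun, ZMod.card, Nat.cast_pow]
  field_simp

end SumLaw

section DecodingError

variable {q k m : ℕ} [NeZero q] {Y : Type*} [Fintype Y] (Q : ZMod q → ZMod q → PMF Y)
  (S : (Fin (k + m) → Y) → Finset (Fin (k + m) → Fin (2 * q - 1)))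

/-- The probability that the syndrome decoder with list `S y` for the output `y` of the channel `Q`
errs on the first `k` entries of `U₁ + U₂`, when the inputs are `U₁` and `U₂`. -/
noncomputable def decodingError (A : Fin k → ZMod (q ^ m)) (U₁ U₂ : Fin (k + m) → ZMod q) : ℝ :=
  ∑ y, if syndromeDecoder (S y) A ((splitEquiv A U₁).2 + (splitEquiv A U₂).2) =
      fun i => intSum (U₁ (Fin.castAdd m i)) (U₂ (Fin.castAdd m i))
    then 0 else ∏ i, (Q (U₁ i) (U₂ i) (y i)).toReal

lemma expect_decodingError_le {L : ℝ} (hL : ∀ y, ((S y).card : ℝ) ≤ L) :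
    (𝔼 A, 𝔼 U₁, 𝔼 U₂, decodingError Q S A U₁ U₂) ≤
      (∑ w, ∑ y, if w ∈ S y then 0 else ∏ i, sumLaw Q (w i) (y i)) +
        L * (2 * q / (q : ℝ) ^ m) := by
  set ε : ℝ := L * (2 * q / (q : ℝ) ^ m) with hε
  set F : (Fin k → ZMod (q ^ m)) → (Fin (k + m) → Fin (2 * q - 1)) → (Fin (k + m) → Y) → ℝ :=
    fun A w y => if syndromeDecoder (S y) A (sumSyndrome A w) = fun i => w (Fin.castAdd m i)
      then 0 else 1 with hF
  have herror (A : Fin k → ZMod (q ^ m)) (U₁ U₂ : Fin (k + m) → ZMod q) :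
      decodingError Q S A U₁ U₂ = ∑ y, (∏ i, (Q (U₁ i) (U₂ i) (y i)).toReal) *
        F A (fun i => intSum (U₁ i) (U₂ i)) y := by
    simp only [decodingError, hF, sumSyndrome_intSum, mul_ite, mul_zero, mul_one]
  have hF_le (w : Fin (k + m) → Fin (2 * q - 1)) (y : Fin (k + m) → Y) :
      (𝔼 A, F A w y) ≤ (if w ∈ S y then 0 else 1) + ε := by
    refine (expect_syndromeDecoder_ne_le (S y) w).trans ?_
    rw [hε]
    gcongr
    exact hL y
  calc
    _ = 𝔼 A, ∑ w, ∑ y, (∏ i, sumLaw Q (w i) (y i)) * F A w y := by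
      simp only [herror, expect_expect_sum_prod_mul]
    _ = ∑ w, ∑ y, (∏ i, sumLaw Q (w i) (y i)) * 𝔼 A, F A w y := by
      simp only [Finset.expect_sum_comm, Finset.mul_expect]
    _ ≤ ∑ w, ∑ y, (∏ i, sumLaw Q (w i) (y i)) * ((if w ∈ S y then 0 else 1) + ε) :=
      Finset.sum_le_sum fun w _ => Finset.sum_le_sum fun y _ =>
        mul_le_mul_of_nonneg_left (hF_le w y) (Finset.prod_nonneg fun i _ => sumLaw_nonneg Q _ _)
    _ = _ := by
      simp only [mul_add, mul_ite, mul_zero, mul_one, Finset.sum_add_distrib, ← Finset.sum_mul,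
        sum_sum_prod_sumLaw, one_mul]

end DecodingError

section AvgError

variable {q n : ℕ} {X₁ X₂ Y M N : Type*} [Fintype Y] (c : ComputationCode q X₁ X₂ Y M N n)
  (P : X₁ → X₂ → PMF Y)

lemma ComputationCode.condError_nonneg (a : M) (b : N) : 0 ≤ c.condError P a b :=
  Finset.sum_nonneg fun y _ => by split_ifs <;> positivity

variable [Fintype M] [Fintype N]

lemma ComputationCode.avgError_eq_expect : c.avgError P = 𝔼 a, 𝔼 b, c.condError P a b := by
  simp only [avgError, Fintype.expect_eq_sum_div_card, div_eq_mul_inv, Finset.sum_mul, one_mul]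
  exact Finset.sum_congr rfl fun a _ => Finset.sum_congr rfl fun b _ => by ring

lemma ComputationCode.avgError_nonneg : 0 ≤ c.avgError P := by
  rw [avgError_eq_expect]
  exact Finset.expect_nonneg fun a _ => Finset.expect_nonneg fun b _ => c.condError_nonneg P a b

end AvgError

section HashCode

variable {q k m : ℕ} {Y M N : Type*}

lemma append_add_zero_injective {ι : M → Fin k → ZMod q} (h : Function.Injective ι)
    (s : Fin k → ZMod q) :
    Function.Injective fun a => (Fin.append (ι a + s) 0 : Fin (k + m) → ZMod q) := by
  refine fun a a' haa' => h (add_right_cancel (b := s) (funext fun i => ?_))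
  simpa only [Fin.append_left] using congrFun haa' (Fin.castAdd m i)

variable [NeZero q] {ι₁ : M → Fin k → ZMod q} {ι₂ : N → Fin k → ZMod q} (h₁ : Function.Injective ι₁)
  (h₂ : Function.Injective ι₂) (S : (Fin (k + m) → Y) → Finset (Fin (k + m) → Fin (2 * q - 1)))
  (A : Fin k → ZMod (q ^ m)) (s₁ s₂ : (Fin k → ZMod q) × ZMod (q ^ m))

/-- A computation code built on the syndrome decoder, for the channel with inputs in `ZMod q`. The
codewords carry the dithered message in their first `k` symbols and are zero elsewhere; the
encoder of user `j` replaces the zeros by digits that make the syndrome equal to `s_j.2`. So the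
decoder, which searches the list `S y`, knows the syndrome of the integer sum. -/
noncomputable def hashCode : ComputationCode q (ZMod q) (ZMod q) Y M N (k + m) where
  t a := Fin.append (ι₁ a + s₁.1) 0
  v b := Fin.append (ι₂ b + s₂.1) 0
  t_injective := append_add_zero_injective h₁ s₁.1
  v_injective := append_add_zero_injective h₂ s₂.1
  enc₁ c := (splitEquiv A).symm (fun i => c (Fin.castAdd m i), s₁.2)
  enc₂ c := (splitEquiv A).symm (fun i => c (Fin.castAdd m i), s₂.2)
  dec y := Fin.append (syndromeDecoder (S y) A (s₁.2 + s₂.2)) fun _ => intSum 0 0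

lemma hashCode_dec_eq_iff (y : Fin (k + m) → Y) (a : M) (b : N) :
    (∀ i, ((hashCode h₁ h₂ S A s₁ s₂).dec y i : ℕ) =
      ((hashCode h₁ h₂ S A s₁ s₂).t a i).val + ((hashCode h₁ h₂ S A s₁ s₂).v b i).val) ↔
      syndromeDecoder (S y) A (s₁.2 + s₂.2) =
        fun i => intSum ((ι₁ a + s₁.1) i) ((ι₂ b + s₂.1) i) := by
  simp [hashCode, Fin.forall_fin_add, intSum, funext_iff, Fin.ext_iff]

variable [Fintype Y] (Q : ZMod q → ZMod q → PMF Y)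

lemma hashCode_condError (a : M) (b : N) :
    (hashCode h₁ h₂ S A s₁ s₂).condError Q a b =
      decodingError Q S A ((splitEquiv A).symm ((ι₁ a, 0) + s₁))
        ((splitEquiv A).symm ((ι₂ b, 0) + s₂)) := by
  have hinput (s : (Fin k → ZMod q) × ZMod (q ^ m)) (u : Fin k → ZMod q) :
      (fun i => (u + s.1) i, s.2) = (u, 0) + s :=
    Prod.ext rfl (zero_add _).symm
  simp only [ComputationCode.condError, decodingError, hashCode_dec_eq_iff, Equiv.apply_symm_apply,
    splitEquiv_symm_castAdd, Prod.snd_add, Prod.fst_add, zero_add]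
  simp only [hashCode, Fin.append_left, hinput]

variable [Fintype M] [Fintype N]

lemma expect_hashCode_avgError [Nonempty M] [Nonempty N] :
    (𝔼 s₁, 𝔼 s₂, (hashCode h₁ h₂ S A s₁ s₂).avgError Q) =
      𝔼 U₁, 𝔼 U₂, decodingError Q S A U₁ U₂ := by
  have huniform (x₁ x₂ : (Fin k → ZMod q) × ZMod (q ^ m)) :
      (𝔼 s₁, 𝔼 s₂, decodingError Q S A ((splitEquiv A).symm (x₁ + s₁))
        ((splitEquiv A).symm (x₂ + s₂))) = 𝔼 U₁, 𝔼 U₂, decodingError Q S A U₁ U₂ :=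
    Fintype.expect_equiv ((Equiv.addLeft x₁).trans (splitEquiv A).symm) _ _ fun s₁ =>
      Fintype.expect_equiv ((Equiv.addLeft x₂).trans (splitEquiv A).symm) _ _ fun s₂ => rfl
  calc
    _ = 𝔼 s₁, 𝔼 s₂, 𝔼 a, 𝔼 b, decodingError Q S A ((splitEquiv A).symm ((ι₁ a, 0) + s₁))
          ((splitEquiv A).symm ((ι₂ b, 0) + s₂)) := by
      simp only [ComputationCode.avgError_eq_expect, hashCode_condError]
    _ = 𝔼 a, 𝔼 b, 𝔼 s₁, 𝔼 s₂, decodingError Q S A ((splitEquiv A).symm ((ι₁ a, 0) + s₁))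
          ((splitEquiv A).symm ((ι₂ b, 0) + s₂)) := by
      simp only [Finset.expect_comm (s := Finset.univ (α := (Fin k → ZMod q) × ZMod (q ^ m)))
        (t := Finset.univ (α := N)),
        Finset.expect_comm (s := Finset.univ (α := (Fin k → ZMod q) × ZMod (q ^ m)))
        (t := Finset.univ (α := M))]
    _ = 𝔼 U₁, 𝔼 U₂, decodingError Q S A U₁ U₂ := by
      simp only [huniform, Fintype.expect_const]

theorem exists_hashCode_avgError_le [Nonempty M] [Nonempty N] {L : ℝ}
    (hL : ∀ y, ((S y).card : ℝ) ≤ L) :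
    ∃ A s₁ s₂, (hashCode h₁ h₂ S A s₁ s₂).avgError Q ≤
      (∑ w, ∑ y, if w ∈ S y then 0 else ∏ i, sumLaw Q (w i) (y i)) +
        L * (2 * q / (q : ℝ) ^ m) := by
  have haverage := expect_decodingError_le Q S hL
  simp only [← expect_hashCode_avgError h₁ h₂ S _ Q] at haverage
  obtain ⟨A, -, hA⟩ := Finset.exists_le_of_expect_le Finset.univ_nonempty haverage
  obtain ⟨s₁, -, hs₁⟩ := Finset.exists_le_of_expect_le Finset.univ_nonempty hA
  obtain ⟨s₂, -, hs₂⟩ := Finset.exists_le_of_expect_le Finset.univ_nonempty hs₁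
  exact ⟨A, s₁, s₂, hs₂⟩

end HashCode

section Prefix

variable {Z₁ Z₂ X₁ X₂ Y : Type*} (V₁ : Z₁ → PMF X₁) (V₂ : Z₂ → PMF X₂) (P : X₁ → X₂ → PMF Y)

/-- The channel `P` preceded by the random maps `V₁` and `V₂`, one at each of its inputs. -/
noncomputable def prefixChannel (z₁ : Z₁) (z₂ : Z₂) : PMF Y :=
  (V₁ z₁).bind fun x₁ => (V₂ z₂).bind (P x₁)

variable {q n : ℕ} {M N : Type*} [Fintype Y]

/-- The error probability given the messages `a` and `b` when the encoders of `c` are bypassed and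
the channel inputs are `x₁` and `x₂`. -/
noncomputable def ComputationCode.inputError (c : ComputationCode q Z₁ Z₂ Y M N n) (a : M) (b : N)
    (x₁ : Fin n → X₁) (x₂ : Fin n → X₂) : ℝ :=
  ∑ y : Fin n → Y,
    if ∀ i, (c.dec y i : ℕ) = (c.t a i).val + (c.v b i).val then 0
    else ∏ i, (P (x₁ i) (x₂ i) (y i)).toReal

variable (c : ComputationCode q Z₁ Z₂ Y M N n)

lemma ComputationCode.condError_prefixChannel [Fintype X₁] [Fintype X₂] (a : M) (b : N) :
    c.condError (prefixChannel V₁ V₂ P) a b =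
      ∑ x₁ : Fin n → X₁, (∏ i, (V₁ (c.enc₁ (c.t a) i) (x₁ i)).toReal) *
        ∑ x₂ : Fin n → X₂, (∏ i, (V₂ (c.enc₂ (c.v b) i) (x₂ i)).toReal) *
          c.inputError P a b x₁ x₂ := by
  simp only [condError, inputError, prefixChannel, prod_toReal_bind_apply, Finset.sum_ite,
    Finset.sum_const_zero, zero_add, Finset.mul_sum]
  rw [Finset.sum_comm]
  exact Finset.sum_congr rfl fun x₁ _ => Finset.sum_comm

variable [Fintype M] [Fintype N]

theorem ComputationCode.exists_avgError_le_prefixChannel [Finite X₁] [Finite X₂] :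
    ∃ c' : ComputationCode q X₁ X₂ Y M N n, c'.t = c.t ∧ c'.v = c.v ∧
      c'.avgError P ≤ c.avgError (prefixChannel V₁ V₂ P) := by
  cases nonempty_fintype X₁
  cases nonempty_fintype X₂
  set w₁ : M → (Fin n → X₁) → ℝ := fun a x => ∏ i, (V₁ (c.enc₁ (c.t a) i) (x i)).toReal
  set w₂ : N → (Fin n → X₂) → ℝ := fun b x => ∏ i, (V₂ (c.enc₂ (c.v b) i) (x i)).toReal
  obtain ⟨x₁, hx₁⟩ := exists_expect_le_expect_sum_mul (w := w₁)
    (fun a x => by positivity) (fun a => sum_prod_toReal_pmf _)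
    fun a x => 𝔼 b, ∑ x', w₂ b x' * c.inputError P a b x x'
  obtain ⟨x₂, hx₂⟩ := exists_expect_le_expect_sum_mul (w := w₂)
    (fun b x => by positivity) (fun b => sum_prod_toReal_pmf _)
    fun b x => 𝔼 a, c.inputError P a b (x₁ a) x
  refine ⟨{ c with
    enc₁ := Function.extend c.t x₁ fun u i => (V₁ (c.enc₁ u i)).support_nonempty.some
    enc₂ := Function.extend c.v x₂ fun u i => (V₂ (c.enc₂ u i)).support_nonempty.some },
    rfl, rfl, ?_⟩
  calc
    _ = 𝔼 a, 𝔼 b, c.inputError P a b (x₁ a) (x₂ b) := by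
      simp only [avgError_eq_expect, condError, c.t_injective.extend_apply,
        c.v_injective.extend_apply, inputError]
    _ = 𝔼 b, 𝔼 a, c.inputError P a b (x₁ a) (x₂ b) := Finset.expect_comm ..
    _ ≤ 𝔼 b, ∑ x, w₂ b x * 𝔼 a, c.inputError P a b (x₁ a) x := hx₂
    _ = 𝔼 a, 𝔼 b, ∑ x, w₂ b x * c.inputError P a b (x₁ a) x := by
      simp only [Finset.mul_expect, ← Finset.expect_sum_comm]
      exact Finset.expect_comm ..
    _ ≤ 𝔼 a, ∑ x, w₁ a x * 𝔼 b, ∑ x', w₂ b x' * c.inputError P a b x x' := hx₁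
    _ = c.avgError (prefixChannel V₁ V₂ P) := by
      simp only [avgError_eq_expect, condError_prefixChannel, Finset.mul_expect,
        ← Finset.expect_sum_comm, w₁, w₂]

end Prefix

section RateBound

variable {q : ℕ} [NeZero q] {X₁ X₂ Y : Type*} [Fintype X₁] [Fintype X₂]
  (V₁ : ZMod q → PMF X₁) (V₂ : ZMod q → PMF X₂) (P : X₁ → X₂ → PMF Y)

lemma PWY_eq_sumLaw : PWY q V₁ V₂ P = sumLaw (prefixChannel V₁ V₂ P) := by
  funext w y
  simp only [PWY, PUUY, sumLaw, prefixChannel, toReal_bind_apply, Finset.sum_filter,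
    Fintype.sum_prod_type, intSum, Fin.ext_iff, Finset.mul_sum, mul_assoc]

lemma mutualInfo_PWY_sub_D [Fintype Y] :
    mutualInfo (PWY q V₁ V₂ P) - D q =
      Real.logb 2 q - condEntropy (sumLaw (prefixChannel V₁ V₂ P)) := by
  simp only [PWY_eq_sumLaw, mutualInfo, D, condEntropy, sum_sumLaw_output]
  ring

lemma mutualInfo_PWY_sub_D_le [Fintype Y] : mutualInfo (PWY q V₁ V₂ P) - D q ≤ Real.logb 2 q := by
  rw [mutualInfo_PWY_sub_D]
  exact sub_le_self _ (condEntropy_nonneg (sumLaw_nonneg _))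

end RateBound

section ZeroPad

variable {q k l n : ℕ}

lemma zeroPad_injective (h : k ≤ l) :
    Function.Injective (zeroPad l : (Fin k → ZMod q) → Fin l → ZMod q) := fun m m' hm =>
  funext fun i => by simpa [zeroPad] using congrFun hm (Fin.castLE h i)

lemma zeroPad_zeroPad (h : k ≤ l) (m : Fin k → ZMod q) :
    zeroPad n (zeroPad l m) = zeroPad n m := by
  funext i
  by_cases hi : (i : ℕ) < k
  · simp [zeroPad, hi, hi.trans_le h]
  · simp [zeroPad, hi]

lemma append_add_zero_eq (u e : Fin k → ZMod q) :
    Fin.append (u + e) (0 : Fin n → ZMod q) = zeroPad (k + n) u + Fin.append e 0 := by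
  funext i
  induction i using Fin.addCases <;> simp [zeroPad]

/-- The matrix that appends zeros to a vector, a generator matrix of the codes constructed here. -/
def padMatrix (q n l : ℕ) : Matrix (Fin n) (Fin l) (ZMod q) :=
  Matrix.of fun i j => if (i : ℕ) = j then 1 else 0

lemma padMatrix_mulVec (x : Fin l → ZMod q) : (padMatrix q n l).mulVec x = zeroPad n x := by
  funext i
  simp only [padMatrix, Matrix.mulVec, dotProduct, Matrix.of_apply, ite_mul, one_mul, zero_mul,
    zeroPad]
  split_ifs with h
  · rw [Finset.sum_eq_single ⟨i, h⟩ (fun j _ hj => if_neg fun hij => hj (Fin.ext hij.symm))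
      (by simp)]
    simp
  · exact Finset.sum_eq_zero fun j _ => if_neg fun hij : (i : ℕ) = j => h (hij ▸ j.is_lt)

end ZeroPad

section DitheredPad

variable {q k n : ℕ} {X₁ X₂ Y M N : Type*} {ι₁ : M → Fin k → ZMod q} {ι₂ : N → Fin k → ZMod q}

/-- The codewords are the messages, identified by `ι₁` and `ι₂` with vectors of length `k`, padded
with zeros and shifted by dithers. -/
def ComputationCode.IsDitheredPad (c : ComputationCode q X₁ X₂ Y M N n) (ι₁ : M → Fin k → ZMod q)
    (ι₂ : N → Fin k → ZMod q) : Prop :=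
  ∃ d₁ d₂, (∀ a, c.t a = zeroPad n (ι₁ a) + d₁) ∧ ∀ b, c.v b = zeroPad n (ι₂ b) + d₂

lemma ComputationCode.IsDitheredPad.isNestedLinear {k₁ k₂ : ℕ}
    {c : ComputationCode q X₁ X₂ Y (Fin k₁ → ZMod q) (Fin k₂ → ZMod q) n}
    (hc : c.IsDitheredPad (zeroPad k) (zeroPad k)) (h₁ : k₁ ≤ k) (h₂ : k₂ ≤ k) (hk : k ≤ n) :
    c.IsNestedLinear := by
  obtain ⟨d₁, d₂, ht, hv⟩ := hc
  refine ⟨padMatrix q n _, d₁, d₂, ?_, fun m => ?_, fun m => ?_⟩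
  · simpa only [funext padMatrix_mulVec] using zeroPad_injective ((max_le h₁ h₂).trans hk)
  · rw [padMatrix_mulVec, ht, zeroPad_zeroPad h₁, zeroPad_zeroPad (le_max_left k₁ k₂)]
  · rw [padMatrix_mulVec, hv, zeroPad_zeroPad h₂, zeroPad_zeroPad (le_max_right k₁ k₂)]

variable [NeZero q] [Fintype Y] [Fintype M] [Fintype N]

lemma exists_isDitheredPad_avgError_eq_zero (h₁ : Function.Injective ι₁)
    (h₂ : Function.Injective ι₂) (hk : k = 0) [Nonempty X₁] [Nonempty X₂]
    (P : X₁ → X₂ → PMF Y) :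
    ∃ c : ComputationCode q X₁ X₂ Y M N n, c.IsDitheredPad ι₁ ι₂ ∧ c.avgError P = 0 := by
  subst hk
  have := h₁.subsingleton
  have := h₂.subsingleton
  refine ⟨{
    t := fun _ => 0
    v := fun _ => 0
    t_injective := Function.injective_of_subsingleton _
    v_injective := Function.injective_of_subsingleton _
    enc₁ := fun _ _ => Classical.arbitrary X₁
    enc₂ := fun _ _ => Classical.arbitrary X₂
    dec := fun _ _ => intSum 0 0 }, ?_, ?_⟩
  · exact ⟨0, 0, fun a => by ext; simp [zeroPad], fun b => by ext; simp [zeroPad]⟩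
  · simp [ComputationCode.avgError, ComputationCode.condError, intSum]

lemma exists_isDitheredPad_avgError_le (h₁ : Function.Injective ι₁) (h₂ : Function.Injective ι₂)
    (hk : k ≤ n) [Nonempty M] [Nonempty N] [Finite X₁] [Finite X₂] (V₁ : ZMod q → PMF X₁)
    (V₂ : ZMod q → PMF X₂) (P : X₁ → X₂ → PMF Y) (τ : ℝ) :
    ∃ c : ComputationCode q X₁ X₂ Y M N n, c.IsDitheredPad ι₁ ι₂ ∧ c.avgError P ≤
      (∑ w : Fin n → Fin (2 * q - 1), ∑ y : Fin n → Y,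
        if w ∈ typicalSet (sumLaw (prefixChannel V₁ V₂ P)) τ y then 0
        else ∏ i, sumLaw (prefixChannel V₁ V₂ P) (w i) (y i)) +
      2 ^ (n * τ) * (2 * q / (q : ℝ) ^ (n - k)) := by
  obtain ⟨m, rfl⟩ := Nat.exists_eq_add_of_le hk
  rw [Nat.add_sub_cancel_left]
  obtain ⟨A, s₁, s₂, herror⟩ := exists_hashCode_avgError_le h₁ h₂
    (typicalSet (sumLaw (prefixChannel V₁ V₂ P)) τ) (prefixChannel V₁ V₂ P)
    (card_typicalSet_le (sumLaw_nonneg _) τ)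
  obtain ⟨c, ht, hv, hc⟩ :=
    (hashCode h₁ h₂ _ A s₁ s₂).exists_avgError_le_prefixChannel V₁ V₂ P
  refine ⟨c, ⟨Fin.append s₁.1 0, Fin.append s₂.1 0, fun a => ?_, fun b => ?_⟩, hc.trans herror⟩
  · rw [ht, ← append_add_zero_eq]
    rfl
  · rw [hv, ← append_add_zero_eq]
    rfl

end DitheredPad

section Achievability

variable {q : ℕ}

lemma pow_ceil_le (hq : 1 < q) {R : ℝ} (hR : 0 ≤ R) (n : ℕ) :
    (q : ℝ) ^ ⌈n * R / Real.logb 2 q⌉₊ ≤ q * ((2 : ℝ) ^ R) ^ n := by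
  have hq1 : (1 : ℝ) < q := Nat.one_lt_cast.mpr hq
  have hq0 : (0 : ℝ) < q := zero_lt_one.trans hq1
  have hlog : 0 < Real.logb 2 q := Real.logb_pos one_lt_two hq1
  have hexp : (q : ℝ) ^ (n * R / Real.logb 2 q) = ((2 : ℝ) ^ R) ^ n := by
    nth_rewrite 1 [← Real.rpow_logb two_pos (by norm_num) hq0]
    rw [← Real.rpow_mul zero_le_two, mul_div_cancel₀ _ hlog.ne', mul_comm,
      Real.rpow_mul_natCast zero_le_two]
  calc (q : ℝ) ^ ⌈n * R / Real.logb 2 q⌉₊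
      ≤ (q : ℝ) ^ (n * R / Real.logb 2 q + 1) := by
        rw [← Real.rpow_natCast]
        exact Real.rpow_le_rpow_of_exponent_le hq1.le (Nat.ceil_lt_add_one (by positivity)).le
    _ = q * ((2 : ℝ) ^ R) ^ n := by rw [Real.rpow_add_one hq0.ne', hexp, mul_comm]

lemma rpow_mul_div_pow_sub_ceil_le (hq : 1 < q) {R : ℝ} (hR : 0 ≤ R) {n : ℕ}
    (hn : ⌈n * R / Real.logb 2 q⌉₊ ≤ n) (τ : ℝ) :
    (2 : ℝ) ^ (n * τ) * (2 * q / (q : ℝ) ^ (n - ⌈n * R / Real.logb 2 q⌉₊)) ≤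
      2 * (q : ℝ) ^ 2 * ((2 : ℝ) ^ (τ + R) / q) ^ n := by
  have hq0 : (0 : ℝ) < q := Nat.cast_pos.mpr (zero_lt_one.trans hq)
  calc
    _ = 2 * q * ((2 : ℝ) ^ τ) ^ n * (q : ℝ) ^ ⌈n * R / Real.logb 2 q⌉₊ / (q : ℝ) ^ n := by
      rw [pow_sub₀ _ hq0.ne' hn, mul_comm (n : ℝ), Real.rpow_mul_natCast zero_le_two]
      field_simp
    _ ≤ 2 * q * ((2 : ℝ) ^ τ) ^ n * (q * ((2 : ℝ) ^ R) ^ n) / (q : ℝ) ^ n := by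
      gcongr
      exact pow_ceil_le hq hR n
    _ = _ := by
      rw [Real.rpow_add two_pos, div_pow, mul_pow]
      ring

lemma ceil_mul_div_logb_le (hq : 1 < q) {R : ℝ} (hR : R ≤ Real.logb 2 q) (n : ℕ) :
    ⌈n * R / Real.logb 2 q⌉₊ ≤ n :=
  Nat.ceil_le.mpr ((div_le_iff₀ (Real.logb_pos one_lt_two (Nat.one_lt_cast.mpr hq))).mpr
    (mul_le_mul_of_nonneg_left hR n.cast_nonneg))

lemma exists_injective_of_le (hq : 1 < q) {r R : ℝ} (hr : r ≤ R) (n : ℕ) :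
    ∃ ι : Fin ⌈(2 : ℝ) ^ (n * r)⌉₊ → Fin ⌈n * R / Real.logb 2 q⌉₊ → ZMod q,
      Function.Injective ι := by
  have : NeZero q := ⟨(zero_lt_one.trans hq).ne'⟩
  have hq1 : (1 : ℝ) < q := Nat.one_lt_cast.mpr hq
  have hlog : 0 < Real.logb 2 q := Real.logb_pos one_lt_two hq1
  suffices hcard : Fintype.card (Fin ⌈(2 : ℝ) ^ (n * r)⌉₊) ≤
      Fintype.card (Fin ⌈n * R / Real.logb 2 q⌉₊ → ZMod q) by
    obtain ⟨e⟩ := Function.Embedding.nonempty_of_card_le hcard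
    exact ⟨e, e.injective⟩
  simp only [Fintype.card_fin, Fintype.card_fun, ZMod.card]
  rw [Nat.ceil_le, Nat.cast_pow, ← Real.rpow_natCast]
  calc (2 : ℝ) ^ (n * r) ≤ (2 : ℝ) ^ (Real.logb 2 q * (n * R / Real.logb 2 q)) := by
        rw [mul_div_cancel₀ _ hlog.ne']
        gcongr
        exact one_le_two
    _ = (q : ℝ) ^ (n * R / Real.logb 2 q) := by
        rw [Real.rpow_mul zero_le_two,
          Real.rpow_logb two_pos (by norm_num) (zero_lt_one.trans hq1)]
    _ ≤ _ := Real.rpow_le_rpow_of_exponent_le hq1.le (Nat.le_ceil _)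

variable [NeZero q] {X₁ X₂ Y : Type*} [Fintype X₁] [Fintype X₂] [Fintype Y]
  {V₁ : ZMod q → PMF X₁} {V₂ : ZMod q → PMF X₂} {P : X₁ → X₂ → PMF Y}

theorem exists_isDitheredPad_tendsto_avgError (hq : 1 < q) {R : ℝ}
    (hR : R < mutualInfo (PWY q V₁ V₂ P) - D q) {M N : ℕ → Type*} [∀ n, Fintype (M n)]
    [∀ n, Fintype (N n)] [∀ n, Nonempty (M n)] [∀ n, Nonempty (N n)]
    {ι₁ : ∀ n : ℕ, M n → Fin ⌈n * R / Real.logb 2 q⌉₊ → ZMod q}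
    {ι₂ : ∀ n : ℕ, N n → Fin ⌈n * R / Real.logb 2 q⌉₊ → ZMod q}
    (h₁ : ∀ n, Function.Injective (ι₁ n)) (h₂ : ∀ n, Function.Injective (ι₂ n)) :
    ∃ c : ∀ n, ComputationCode q X₁ X₂ Y (M n) (N n) n,
      (∀ n, (c n).IsDitheredPad (ι₁ n) (ι₂ n)) ∧
      Tendsto (fun n => (c n).avgError P) atTop (𝓝 0) := by
  have hlength := ceil_mul_div_logb_le hq (hR.le.trans (mutualInfo_PWY_sub_D_le V₁ V₂ P))
  have hq0 : (0 : ℝ) < q := Nat.cast_pos.mpr (zero_lt_one.trans hq)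
  rw [mutualInfo_PWY_sub_D, lt_sub_comm] at hR
  obtain ⟨τ, hτ, hτR⟩ := exists_between hR
  have hbase : (2 : ℝ) ^ (τ + R) / q < 1 := by
    rw [div_lt_one hq0, ← Real.lt_logb_iff_rpow_lt one_lt_two hq0]
    linarith
  obtain ⟨ρ, hρ0, hρ1, hρ⟩ :=
    exists_sum_notMem_typicalSet_le_pow (sumLaw_nonneg _) (sum_sum_sumLaw _) hτ
  have hcode (n : ℕ) : ∃ c : ComputationCode q X₁ X₂ Y (M n) (N n) n,
      c.IsDitheredPad (ι₁ n) (ι₂ n) ∧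
        c.avgError P ≤ ρ ^ n + 2 * (q : ℝ) ^ 2 * ((2 : ℝ) ^ (τ + R) / q) ^ n := by
    rcases lt_or_ge R 0 with hneg | hnonneg
    · have : Nonempty X₁ := (V₁ 0).support_nonempty.to_type
      have : Nonempty X₂ := (V₂ 0).support_nonempty.to_type
      have hzero : ⌈n * R / Real.logb 2 q⌉₊ = 0 := Nat.ceil_eq_zero.mpr
        (div_nonpos_of_nonpos_of_nonneg (mul_nonpos_of_nonneg_of_nonpos n.cast_nonneg hneg.le)
          (Real.logb_pos one_lt_two (Nat.one_lt_cast.mpr hq)).le)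
      obtain ⟨c, hc, herror⟩ := exists_isDitheredPad_avgError_eq_zero (h₁ n) (h₂ n) hzero P
      exact ⟨c, hc, herror.trans_le (by positivity)⟩
    · obtain ⟨c, hc, herror⟩ :=
        exists_isDitheredPad_avgError_le (h₁ n) (h₂ n) (hlength n) V₁ V₂ P τ
      exact ⟨c, hc, herror.trans
        (add_le_add (hρ n) (rpow_mul_div_pow_sub_ceil_le hq hnonneg (hlength n) τ))⟩
  choose c hc herror using hcode
  refine ⟨c, hc, squeeze_zero (fun n => (c n).avgError_nonneg P) herror ?_⟩
  simpa using (tendsto_pow_atTop_nhds_zero_of_lt_one hρ0 hρ1).add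
    ((tendsto_pow_atTop_nhds_zero_of_lt_one (by positivity) hbase).const_mul (2 * (q : ℝ) ^ 2))

lemma isAchievable_of_lt (hq : 1 < q) {R₁ R₂ : ℝ}
    (hR : max R₁ R₂ < mutualInfo (PWY q V₁ V₂ P) - D q) : IsAchievable q P R₁ R₂ := by
  have (r : ℝ) (n : ℕ) : Nonempty (Fin ⌈(2 : ℝ) ^ (n * r)⌉₊) :=
    ⟨⟨0, Nat.ceil_pos.mpr (by positivity)⟩⟩
  choose ι₁ h₁ using exists_injective_of_le hq (le_max_left R₁ R₂)
  choose ι₂ h₂ using exists_injective_of_le hq (le_max_right R₁ R₂)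
  obtain ⟨c, -, hc⟩ := exists_isDitheredPad_tendsto_avgError hq hR h₁ h₂
  exact ⟨c, hc⟩

lemma isAchievableByNestedLinear_of_lt (hq : 1 < q) {R₁ R₂ : ℝ}
    (hR : max R₁ R₂ < mutualInfo (PWY q V₁ V₂ P) - D q) :
    IsAchievableByNestedLinear q P R₁ R₂ := by
  have hlog : 0 < Real.logb 2 q := Real.logb_pos one_lt_two (Nat.one_lt_cast.mpr hq)
  have hdim {r : ℝ} (hr : r ≤ max R₁ R₂) (n : ℕ) :
      ⌊n * r / Real.logb 2 q⌋₊ ≤ ⌈n * max R₁ R₂ / Real.logb 2 q⌉₊ :=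
    (Nat.floor_mono (by gcongr)).trans (Nat.floor_le_ceil _)
  have hdim₁ := hdim (le_max_left R₁ R₂)
  have hdim₂ := hdim (le_max_right R₁ R₂)
  obtain ⟨c, hpad, hc⟩ := exists_isDitheredPad_tendsto_avgError hq hR
    (fun n => zeroPad_injective (hdim₁ n)) fun n => zeroPad_injective (hdim₂ n)
  have hlength := ceil_mul_div_logb_le hq (hR.le.trans (mutualInfo_PWY_sub_D_le V₁ V₂ P))
  exact ⟨c, fun n => (hpad n).isNestedLinear (hdim₁ n) (hdim₂ n) (hlength n), hc⟩

end Achievability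

end SumMAC

theorem theorem4_general (q : ℕ) [NeZero q] (hq : 1 < q)
    {X₁ X₂ Y : Type*} [Fintype X₁] [Fintype X₂] [Fintype Y]
    (P : X₁ → X₂ → PMF Y) (V₁ : ZMod q → PMF X₁) (V₂ : ZMod q → PMF X₂) (R₁ R₂ : ℝ)
    (hR : max R₁ R₂ < SumMAC.mutualInfo (SumMAC.PWY q V₁ V₂ P) - SumMAC.D q) :
    SumMAC.IsAchievable q P R₁ R₂ ∧ SumMAC.IsAchievableByNestedLinear q P R₁ R₂ :=
  ⟨SumMAC.isAchievable_of_lt hq hR, SumMAC.isAchievableByNestedLinear_of_lt hq hR⟩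

theorem theorem4 (q : ℕ) [Fact q.Prime]
    {X₁ X₂ Y : Type*} [Fintype X₁] [Fintype X₂] [Fintype Y]
    (P : X₁ → X₂ → PMF Y) (V₁ : ZMod q → PMF X₁) (V₂ : ZMod q → PMF X₂) (R₁ R₂ : ℝ)
    (hR : max R₁ R₂ < SumMAC.mutualInfo (SumMAC.PWY q V₁ V₂ P) - SumMAC.D q) :
    SumMAC.IsAchievable q P R₁ R₂ ∧ SumMAC.IsAchievableByNestedLinear q P R₁ R₂ :=
  theorem4_general q (Fact.out : q.Prime).one_lt P V₁ V₂ R₁ R₂ hR
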